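/- For sets $S, C \subseteq \omega$, say that $S$ computes $C$ if $C \le_T S$. For a sequence $\vec R = \langle R_i : i \in \omega\rangle$ of subsets of $\omega$, a set $C \subseteq \omega$ is $\vec R$-cohesive if $C$ is infinite and for each $i$, either $C \cap R_i$ or $C \cap (\omega \setminus R_i)$ is finite. A set $A \subseteq \omega$ is arithmetical in $\vec R$ if it is definable by a first-order formula over $(\omega; 0, 1, +, \cdot)$ expanded by a predicate for the join $\{\langle i, x\rangle : x \in R_i\}$, where $\langle\cdot,\cdot\rangle$ is a standard computable pairing function. **Theorem 1.5.** There is a sequence $\vec R = \langle R_i : i \in \omega\rangle$ of subsets of $\omega$ such that for every $m \in \omega$ and every partition of $\omega$ into pairwise disjoint (possibly empty) sets $A_0, \dots, A_{m-1}$, each arithmetical in $\vec R$, there are a $j < m$ and an infinite set $S \subseteq A_j$ such that $S$ computes no $\vec R$-cohesive set. -/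

import Mathlib

namespace CohesiveAvoidance

open FirstOrder

/-- The function symbols of first-order arithmetic with a set parameter: `0`, `1`, `+`, `*`. -/
inductive ArithFunc : ℕ → Type
  | zero : ArithFunc 0
  | one : ArithFunc 0
  | add : ArithFunc 2
  | mul : ArithFunc 2

/-- The only relation symbol besides equality: a unary predicate for membership in the set
parameter. -/
inductive ArithRel : ℕ → Type
  | mem : ArithRel 1

/-- The language of first-order arithmetic with an additional unary set predicate. The order
is definable from addition, so no symbol for it is needed. -/
def arith : Language :=
  { Functions := ArithFunc
    Relations := ArithRel }

/-- The standard model of arithmetic, with the set predicate interpreted as `X`. -/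
@[reducible]
def standardModel (X : Set ℕ) : arith.Structure ℕ where
  funMap := fun f =>
    match f with
    | .zero => fun _ => 0
    | .one => fun _ => 1
    | .add => fun v => v 0 + v 1
    | .mul => fun v => v 0 * v 1
  RelMap := fun r =>
    match r with
    | .mem => fun v => v 0 ∈ X

/-- `A` is arithmetical in `X`: it is definable, without parameters, by a first-order formula in
the standard model of arithmetic expanded by a predicate for `X`. -/
def ArithmeticalIn (X A : Set ℕ) : Prop :=
  letI : arith.Structure ℕ := standardModel X
  (∅ : Set ℕ).Definable₁ arith A

/-- The infinite join of a sequence of sets: the set of all codes of pairs `(i, x)` with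
`x ∈ R i`. -/
def join (R : ℕ → Set ℕ) : Set ℕ :=
  {p | p.unpair.2 ∈ R p.unpair.1}

open Classical in
/-- The characteristic function of a set, as a (total) partial function. -/
noncomputable def char (S : Set ℕ) : ℕ →. ℕ :=
  fun n => Part.some (if n ∈ S then 1 else 0)

/-- `S` computes `C`: the characteristic function of `C` is Turing reducible to that of `S`. -/
def Computes (S C : Set ℕ) : Prop :=
  TuringReducible (char C) (char S)

/-- `S` is cohesive for the sequence `R`. -/
def IsCohesive (R : ℕ → Set ℕ) (S : Set ℕ) : Prop :=
  S.Infinite ∧ ∀ i, (S ∩ R i).Finite ∨ (S ∩ (R i)ᶜ).Finite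

/-- The sets `A 0, …, A (m - 1)` partition `ω`. Parts may be empty. -/
def IsPartition {m : ℕ} (A : Fin m → Set ℕ) : Prop :=
  Pairwise (fun i j => Disjoint (A i) (A j)) ∧ ⋃ j, A j = Set.univ

end CohesiveAvoidance

/-! Take a colouring `c` generic over a countable family `N` of reservoirs, and let the sequence
list the residue classes of `c` modulo every `k + 1`. A cohesive set is almost constant modulo `m +
1`, so against `m` parts it suffices to find `S` computing no infinite set almost homogeneous for `m
+ 1` colours.

Sets `S i ⊆ A i` are built together by Mathias forcing with a common reservoir. Given a code and a
guessed colour for each part, some colour is guessed by no part. Suppose that arbitrarily far out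
there are finite sets of inputs, one of which gets accepted whatever the partition. By genericity
such a set lies entirely in the unguessed colour, and the actual partition makes some part accept a
wrongly coloured input. Otherwise, by compactness, some partition blocks all large inputs. One such
partition has its parts in `N`, and shrinking to an infinite part makes one computed set finite.
This is `exists_le_not_computesHomogeneous`. Since every tuple of requirements is met, one per part,
some `S i` meets all of its own. -/

namespace CohesiveAvoidance

/-! ### Oracle computations and the use principle. -/

/-- Codes for the partial functions that are recursive relative to one oracle. -/
inductive OracleCode : Type
  | zero : OracleCode
  | succ : OracleCode
  | left : OracleCode
  | right : OracleCode
  | oracle : OracleCode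
  | pair : OracleCode → OracleCode → OracleCode
  | comp : OracleCode → OracleCode → OracleCode
  | prec : OracleCode → OracleCode → OracleCode
  | rfind : OracleCode → OracleCode

namespace OracleCode

/-- A Gödel numbering of oracle codes. -/
def godel : OracleCode → ℕ
  | zero => Nat.pair 0 0
  | succ => Nat.pair 1 0
  | left => Nat.pair 2 0
  | right => Nat.pair 3 0
  | oracle => Nat.pair 4 0
  | pair a b => Nat.pair 5 (Nat.pair a.godel b.godel)
  | comp a b => Nat.pair 6 (Nat.pair a.godel b.godel)
  | prec a b => Nat.pair 7 (Nat.pair a.godel b.godel)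
  | rfind a => Nat.pair 8 a.godel

theorem godel_injective : Function.Injective godel := by
  intro a
  induction a with
  | pair a b iha ihb | comp a b iha ihb | prec a b iha ihb =>
    intro b h
    cases b <;> simp [godel, Nat.pair_eq_pair] at h ⊢
    exact ⟨iha h.1, ihb h.2⟩
  | rfind a iha =>
    intro b h
    cases b <;> simp [godel, Nat.pair_eq_pair] at h ⊢
    exact iha h
  | _ =>
    intro b h
    cases b <;> simp [godel, Nat.pair_eq_pair] at h ⊢

instance : Countable OracleCode := godel_injective.countable

/-- The partial function computed by a code with oracle `g`. -/
def eval (g : ℕ →. ℕ) : OracleCode → ℕ →. ℕ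
  | zero => fun _ => Part.some 0
  | succ => fun n => Part.some (n + 1)
  | left => fun n => Part.some n.unpair.1
  | right => fun n => Part.some n.unpair.2
  | oracle => g
  | pair a b => fun n => (a.eval g n).bind fun p => (b.eval g n).map (Nat.pair p)
  | comp a b => fun n => (b.eval g n).bind fun p => a.eval g p
  | prec a b => fun p =>
      p.unpair.2.rec (a.eval g p.unpair.1) fun y IH =>
        IH.bind fun i => b.eval g (Nat.pair p.unpair.1 (Nat.pair y i))
  | rfind a => fun n => Nat.rfind fun k => (a.eval g (Nat.pair n k)).map fun m => decide (m = 0)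

theorem exists_eval_eq {f g : ℕ →. ℕ} (h : TuringReducible f g) : ∃ e : OracleCode, e.eval g = f := by
  rw [TuringReducible, RecursiveIn.iff_nat] at h
  induction h with
  | zero => exact ⟨zero, rfl⟩
  | succ => exact ⟨succ, rfl⟩
  | left => exact ⟨left, rfl⟩
  | right => exact ⟨right, rfl⟩
  | oracle g' hg => exact ⟨oracle, (Set.mem_singleton_iff.1 hg).symm⟩
  | pair _ _ iha ihb =>
    obtain ⟨a, rfl⟩ := iha
    obtain ⟨b, rfl⟩ := ihb
    exact ⟨pair a b, funext fun n => by simp [eval, Seq.seq]⟩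
  | comp _ _ iha ihb =>
    obtain ⟨a, rfl⟩ := iha
    obtain ⟨b, rfl⟩ := ihb
    exact ⟨comp a b, rfl⟩
  | prec _ _ iha ihb =>
    obtain ⟨a, rfl⟩ := iha
    obtain ⟨b, rfl⟩ := ihb
    exact ⟨prec a b, rfl⟩
  | rfind _ iha =>
    obtain ⟨a, rfl⟩ := iha
    exact ⟨rfind a, rfl⟩

end OracleCode

/-- `S` and `T` have the same elements below `u`. -/
def AgreeBelow (u : ℕ) (S T : Set ℕ) : Prop :=
  ∀ y < u, y ∈ S ↔ y ∈ T

namespace OracleCode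

/-- The use principle: a halting oracle computation inspects only finitely much of its oracle. -/
theorem eventually_mem_eval {S : Set ℕ} (e : OracleCode) {x y : ℕ} (h : y ∈ e.eval (char S) x) :
    ∀ᶠ u in Filter.atTop, ∀ T, AgreeBelow u S T → y ∈ e.eval (char T) x := by
  induction e generalizing x y with
  | oracle =>
    filter_upwards [Filter.eventually_gt_atTop x] with u hu T hT
    have hx : char S x = char T x := by
      have hx := hT x hu
      by_cases hS : x ∈ S <;> simp_all [char]
    change y ∈ char T x
    rw [← hx]
    exact h
  | pair a b iha ihb =>
    simp only [eval, Part.mem_bind_iff, Part.mem_map_iff] at h ⊢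
    obtain ⟨p, hp, q, hq, rfl⟩ := h
    filter_upwards [iha hp, ihb hq] with u ha hb T hT
    exact ⟨p, ha T hT, q, hb T hT, rfl⟩
  | comp a b iha ihb =>
    simp only [eval, Part.mem_bind_iff] at h ⊢
    obtain ⟨p, hp, hq⟩ := h
    filter_upwards [ihb hp, iha hq] with u hb ha T hT
    exact ⟨p, hb T hT, ha T hT⟩
  | prec a b iha ihb =>
    simp only [eval] at h ⊢
    generalize x.unpair.2 = n at h
    induction n generalizing y with
    | zero => exact iha h
    | succ n ih =>
      simp only [Part.mem_bind_iff] at h ⊢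
      obtain ⟨p, hp, hq⟩ := h
      filter_upwards [ih hp, ihb hq] with u h1 h2 T hT
      exact ⟨p, h1 T hT, h2 T hT⟩
  | rfind a iha =>
    obtain ⟨hp, hq⟩ := Nat.mem_rfind.1 h
    obtain ⟨p, hp, hp0⟩ := (Part.mem_map_iff _).1 hp
    have hlt : ∀ᶠ u in Filter.atTop, ∀ m ∈ Set.Iio y, ∀ T, AgreeBelow u S T →
        false ∈ (a.eval (char T) (Nat.pair x m)).map fun q => decide (q = 0) := by
      rw [Filter.eventually_all_finite (Set.finite_Iio y)]
      intro m hm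
      obtain ⟨q, hq, hq0⟩ := (Part.mem_map_iff _).1 (hq hm)
      filter_upwards [iha hq] with u hu T hT
      exact (Part.mem_map_iff _).2 ⟨q, hu T hT, hq0⟩
    filter_upwards [iha hp, hlt] with u h1 h2 T hT
    exact Nat.mem_rfind.2 ⟨(Part.mem_map_iff _).2 ⟨p, h1 T hT, hp0⟩, fun hm => h2 _ hm T hT⟩
  | _ => exact Filter.Eventually.of_forall fun T _ _ => h

/-- With oracle `S`, the code `e` answers `1` on input `x`. -/
def Accepts (e : OracleCode) (S : Set ℕ) (x : ℕ) : Prop :=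
  1 ∈ e.eval (char S) x

theorem Accepts.exists_use {e : OracleCode} {S : Set ℕ} {x : ℕ} (h : e.Accepts S x) (b : ℕ) :
    ∃ u ≥ b, ∀ T, AgreeBelow u S T → e.Accepts T x :=
  ((Filter.eventually_ge_atTop b).and (e.eventually_mem_eval h)).exists

end OracleCode

theorem Computes.exists_accepts {S C : Set ℕ} (h : Computes S C) :
    ∃ e : OracleCode, {x | e.Accepts S x} = C := by
  obtain ⟨e, he⟩ := OracleCode.exists_eval_eq h
  refine ⟨e, Set.ext fun x => ?_⟩
  by_cases hx : x ∈ C <;> simp [OracleCode.Accepts, he, char, hx]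


/-! ### Blocking partitions and countable families of reservoirs. -/

/-- For some part `i` of the partition `P`, the stem `F i` has a finite extension by elements of
`X` above `b` in that part, relative to which the code `e i` accepts `x`. -/
def CanAccept {m : ℕ} (X : Set ℕ) (e : Fin m → OracleCode) (F : Fin m → Finset ℕ) (b : ℕ)
    (P : ℕ → Fin m) (x : ℕ) : Prop :=
  ∃ i, ∃ G : Finset ℕ, (∀ y ∈ G, y ∈ X ∧ b < y ∧ P y = i) ∧ (e i).Accepts (F i ∪ G) x

/-- A witness `G` is finite, so it constrains only finitely many values of `P`. -/
theorem isOpen_setOf_canAccept {m : ℕ} (X : Set ℕ) (e : Fin m → OracleCode)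
    (F : Fin m → Finset ℕ) (b x : ℕ) : IsOpen {P | CanAccept X e F b P x} := by
  rw [isOpen_pi_iff]
  rintro P ⟨i, G, hG, hx⟩
  refine ⟨G, fun y => {P y}, fun _ _ => ⟨isOpen_discrete _, rfl⟩, fun Q hQ => ?_⟩
  exact ⟨i, G, fun y hy => ⟨(hG y hy).1, (hG y hy).2.1, (hQ y hy).trans (hG y hy).2.2⟩, hx⟩

/-- If every partition admits acceptance above `n`, then a single finite set of inputs suffices for
all partitions. -/
theorem exists_finset_canAccept {m : ℕ} {X : Set ℕ} {e : Fin m → OracleCode}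
    {F : Fin m → Finset ℕ} {b n : ℕ} (h : ∀ P, ∃ x > n, CanAccept X e F b P x) :
    ∃ E : Finset ℕ, (∀ x ∈ E, n < x) ∧ ∀ P, ∃ x ∈ E, CanAccept X e F b P x := by
  -- The space of partitions `ℕ → Fin m` is compact, as a product of finite discrete spaces.
  obtain ⟨E, hE⟩ := isCompact_univ.elim_finite_subcover
    (fun x : Set.Ioi n => {P | CanAccept X e F b P x})
    (fun x => isOpen_setOf_canAccept X e F b x) (fun P _ => by
      obtain ⟨x, hx, hP⟩ := h P
      exact Set.mem_iUnion.2 ⟨⟨x, hx⟩, hP⟩)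
  refine ⟨E.map (Function.Embedding.subtype _), fun x hx => ?_, fun P => ?_⟩
  · obtain ⟨y, -, rfl⟩ := Finset.mem_map.1 hx
    exact y.2
  · obtain ⟨x, hx, hP⟩ := Set.mem_iUnion₂.1 (hE (Set.mem_univ P))
    exact ⟨x, Finset.mem_map_of_mem _ hx, hP⟩

theorem exists_countable_closed {α ι : Type*} [Countable ι] (f : ι → α → α) (a : α) :
    ∃ N : Set α, N.Countable ∧ a ∈ N ∧ ∀ i, ∀ x ∈ N, f i x ∈ N := by
  refine ⟨Set.range fun l : List ι => l.foldr f a, Set.countable_range _, ⟨[], rfl⟩, ?_⟩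
  rintro i _ ⟨l, rfl⟩
  exact ⟨i :: l, rfl⟩

/-- The family `N` of reservoirs contains the parts of some partition that blocks acceptance,
whenever there is such a partition. -/
def ClosedUnderBlocking (N : Set (Set ℕ)) : Prop :=
  ∀ (m : ℕ) (e : Fin m → OracleCode) (F : Fin m → Finset ℕ) (b n : ℕ), ∀ X ∈ N,
    (∃ P, ∀ x > n, ¬ CanAccept X e F b P x) →
      ∃ P, (∀ x > n, ¬ CanAccept X e F b P x) ∧ ∀ i, X ∩ P ⁻¹' {i} ∈ N

open Classical in
theorem exists_closedUnderBlocking :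
    ∃ N : Set (Set ℕ), N.Countable ∧ Set.univ ∈ N ∧ ClosedUnderBlocking N := by
  let f (d : Σ m, (Fin m → OracleCode) × (Fin m → Finset ℕ) × ℕ × ℕ × Fin m) (X : Set ℕ) : Set ℕ :=
    if h : ∃ P, ∀ x > d.2.2.2.2.1, ¬ CanAccept X d.2.1 d.2.2.1 d.2.2.2.1 P x then
      X ∩ h.choose ⁻¹' {d.2.2.2.2.2} else X
  obtain ⟨N, hN, huniv, hf⟩ := exists_countable_closed f Set.univ
  refine ⟨N, hN, huniv, fun m e F b n X hX h => ⟨h.choose, h.choose_spec, fun i => ?_⟩⟩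
  have := hf ⟨m, e, F, b, n, i⟩ X hX
  simpa only [f, dif_pos h] using this

/-! ### Generic colourings, by Baire category. -/

/-- A colouring that is generic for countably many families of finite sets: each family with
members arbitrarily far out has a member of each constant colour. -/
theorem exists_generic_colouring {α : Type*} [Countable α] (E : α → Set (Finset ℕ)) :
    ∃ c : ℕ → ℕ, ∀ a j, (∀ n, ∃ D ∈ E a, ∀ x ∈ D, n < x) → ∃ D ∈ E a, ∀ x ∈ D, c x = j := by
  let I := {p : α × ℕ // ∀ n, ∃ D ∈ E p.1, ∀ x ∈ D, n < x}
  let U (p : I) : Set (ℕ → ℕ) := {c | ∃ D ∈ E p.1.1, ∀ x ∈ D, c x = p.1.2}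
  have hopen (p : I) : IsOpen (U p) := by
    rw [isOpen_pi_iff]
    rintro c ⟨D, hD, hc⟩
    exact ⟨D, fun y => {c y}, fun _ _ => ⟨isOpen_discrete _, rfl⟩,
      fun c' hc' => ⟨D, hD, fun x hx => (hc' x hx).trans (hc x hx)⟩⟩
  have hdense (p : I) : Dense (U p) := by
    rw [dense_iff_inter_open]
    rintro V hV ⟨c, hc⟩
    obtain ⟨s, u, hu, hs⟩ := isOpen_pi_iff.1 hV c hc
    -- Beyond the support `s` of a basic neighbourhood, `c` can be recoloured on `D` without leaving
    -- it.
    obtain ⟨D, hD, hlt⟩ := p.2 (s.sup id)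
    have hnot : ∀ x ∈ s, x ∉ D := fun x hx hxD =>
      absurd (Finset.le_sup (f := id) hx) (not_le.2 (hlt x hxD))
    refine ⟨fun x => if x ∈ D then p.1.2 else c x, hs fun x hx => ?_, D, hD, fun x hx => if_pos hx⟩
    simpa only [if_neg (hnot x hx)] using (hu x hx).2
  obtain ⟨c, hc⟩ := (dense_iInter_of_isOpen hopen hdense).nonempty
  exact ⟨c, fun a j h => Set.mem_iInter.1 hc ⟨(a, j), h⟩⟩

/-- The finite sets of inputs above `b` one of which can be accepted for every partition. -/
def unavoidable {m : ℕ} (X : Set ℕ) (e : Fin m → OracleCode) (F : Fin m → Finset ℕ) (b : ℕ) :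
    Set (Finset ℕ) :=
  {D | (∀ x ∈ D, b < x) ∧ ∀ P, ∃ x ∈ D, CanAccept X e F b P x}

/-- The colouring `c` is generic with respect to the reservoirs in `N`. -/
def GenericOver (N : Set (Set ℕ)) (c : ℕ → ℕ) : Prop :=
  ∀ (m : ℕ) (e : Fin m → OracleCode) (F : Fin m → Finset ℕ) (b : ℕ), ∀ X ∈ N, ∀ j,
    (∀ n, ∃ D ∈ unavoidable X e F b, ∀ x ∈ D, n < x) →
      ∃ D ∈ unavoidable X e F b, ∀ x ∈ D, c x = j

theorem exists_genericOver {N : Set (Set ℕ)} (hN : N.Countable) : ∃ c, GenericOver N c := by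
  have := hN.to_subtype
  obtain ⟨c, hc⟩ := exists_generic_colouring
    fun a : N × (Σ m, (Fin m → OracleCode) × (Fin m → Finset ℕ) × ℕ) =>
      unavoidable a.1 a.2.2.1 a.2.2.2.1 a.2.2.2.2
  exact ⟨c, fun m e F b X hX j h => hc (⟨X, hX⟩, ⟨m, e, F, b⟩) j h⟩

/-! ### Mathias forcing with a common reservoir. -/

/-- Mathias conditions for building subsets of the sets `A i` simultaneously, with a common
reservoir from `N`. -/
structure Condition (N : Set (Set ℕ)) {m : ℕ} (A : Fin m → Set ℕ) (X₀ : Set ℕ) where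
  /-- The finite part already decided. -/
  stem : Fin m → Finset ℕ
  /-- The set from which later elements are taken. -/
  reservoir : Set ℕ
  /-- Later elements are above this bound. -/
  bound : ℕ
  stem_subset : ∀ i, ↑(stem i) ⊆ A i
  reservoir_mem : reservoir ∈ N
  reservoir_infinite : reservoir.Infinite
  reservoir_subset : reservoir ⊆ X₀

namespace Condition

variable {N : Set (Set ℕ)} {m : ℕ} {A : Fin m → Set ℕ} {X₀ : Set ℕ}

/-- The set `S` is allowed by the condition `p` in part `i`. -/
def Allows (p : Condition N A X₀) (i : Fin m) (S : Set ℕ) : Prop :=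
  ↑(p.stem i) ⊆ S ∧ ∀ x ∈ S, x ∈ p.stem i ∨ x ∈ p.reservoir ∧ p.bound < x

instance : Preorder (Condition N A X₀) where
  le p q := (∀ i, p.Allows i (q.stem i)) ∧ q.reservoir ⊆ p.reservoir ∧ p.bound ≤ q.bound
  le_refl p := ⟨fun i => ⟨subset_rfl, fun x hx => Or.inl hx⟩, subset_rfl, le_rfl⟩
  le_trans p q r hpq hqr := by
    refine ⟨fun i => ⟨(hpq.1 i).1.trans (hqr.1 i).1, fun x hx => ?_⟩, hqr.2.1.trans hpq.2.1,
      hpq.2.2.trans hqr.2.2⟩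
    rcases (hqr.1 i).2 x hx with h | ⟨h, hb⟩
    · exact (hpq.1 i).2 x h
    · exact Or.inr ⟨hpq.2.1 h, hpq.2.2.trans_lt hb⟩

theorem le_def {p q : Condition N A X₀} :
    p ≤ q ↔ (∀ i, p.Allows i (q.stem i)) ∧ q.reservoir ⊆ p.reservoir ∧ p.bound ≤ q.bound :=
  Iff.rfl

/-- If the reservoir meets each `A i` in an infinite set, then stems can be extended. -/
theorem exists_le_stem (hA : ∀ X ∈ N, X ⊆ X₀ → X.Infinite → ∀ i, (X ∩ A i).Infinite)
    (p : Condition N A X₀) (i : Fin m) (n : ℕ) : ∃ q, p ≤ q ∧ ∃ x ∈ q.stem i, n < x := by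
  obtain ⟨x, ⟨hxX, hxA⟩, hx⟩ := (hA p.reservoir p.reservoir_mem p.reservoir_subset
    p.reservoir_infinite i).exists_gt (max n p.bound)
  rw [max_lt_iff] at hx
  refine ⟨{ p with stem := Function.update p.stem i (insert x (p.stem i)), stem_subset := ?_ },
    ⟨fun k => ?_, subset_rfl, le_rfl⟩, x, by simp, hx.1⟩
  · intro k
    rcases eq_or_ne k i with rfl | hk
    · simpa [Set.insert_subset_iff] using ⟨hxA, p.stem_subset k⟩
    · simpa [hk] using p.stem_subset k
  · rcases eq_or_ne k i with rfl | hk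
    · refine ⟨by simp, fun y hy => ?_⟩
      simp only [Function.update_self, Finset.coe_insert, Set.mem_insert_iff, Finset.mem_coe] at hy
      rcases hy with rfl | hy
      · exact Or.inr ⟨hxX, hx.2⟩
      · exact Or.inl hy
    · exact ⟨by simp [hk], fun y hy => Or.inl (by simpa [hk] using hy)⟩

end Condition

/-- For `r = (e, g, b)`: with oracle `S` the code `e` accepts infinitely many inputs, and those above
`b` all have colour `g` under `d`. -/
def ComputesHomogeneous (d : ℕ → ℕ) (S : Set ℕ) (r : OracleCode × ℕ × ℕ) : Prop :=
  {x | r.1.Accepts S x}.Infinite ∧ ∀ x > r.2.2, r.1.Accepts S x → d x = r.2.1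

namespace Condition

variable {N : Set (Set ℕ)} {m : ℕ} {A : Fin m → Set ℕ} {X₀ : Set ℕ}

/-- The disjunctive step: given one requirement for each part, some part can be made to meet its
requirement. -/
theorem exists_le_not_computesHomogeneous (hN : ClosedUnderBlocking N) {c : ℕ → ℕ}
    (hc : GenericOver N c) {K : ℕ} (hK : m < K) (hA : (X₀ \ ⋃ i, A i).Finite)
    (p : Condition N A X₀) (r : Fin m → OracleCode × ℕ × ℕ) :
    ∃ q, p ≤ q ∧ ∃ i, ∀ S, q.Allows i S → ¬ ComputesHomogeneous (fun x => c x % K) S (r i) := by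
  obtain ⟨B, hB⟩ := hA.bddAbove
  have hcover : ∀ x ∈ X₀, B < x → ∃ i, x ∈ A i := fun x hx hBx => by
    by_contra hx'
    exact absurd (hB ⟨hx, by simpa using hx'⟩) (not_le.2 hBx)
  -- Above `b` the sets `A i` cover `X₀`, and every guess `r i` claims to be correct.
  let b := max (max p.bound B) (Finset.univ.sup fun i => (r i).2.2)
  have hpb : p.bound ≤ b := (le_max_left _ _).trans (le_max_left _ _)
  have hBb : B ≤ b := (le_max_right _ _).trans (le_max_left _ _)
  have hrb (i : Fin m) : (r i).2.2 ≤ b :=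
    (Finset.le_sup (f := fun i => (r i).2.2) (Finset.mem_univ i)).trans (le_max_right _ _)
  obtain ⟨x₀, hx₀, hBx₀⟩ := p.reservoir_infinite.exists_gt B
  obtain ⟨i₀, -⟩ := hcover x₀ (p.reservoir_subset hx₀) hBx₀
  let e i := (r i).1
  by_cases h : ∀ n, ∃ D ∈ unavoidable p.reservoir e p.stem b, ∀ x ∈ D, n < x
  -- There are `m < K` guesses, so some colour `j` is wrong for every part.
  · obtain ⟨j, hjK, hj⟩ : ∃ j < K, ∀ i, (r i).2.1 ≠ j := by
      have hcard : (Finset.univ.image fun i => (r i).2.1).card < (Finset.range K).card :=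
        Finset.card_image_le.trans_lt (by simpa using hK)
      obtain ⟨j, hj, hj'⟩ := Finset.exists_mem_notMem_of_card_lt_card hcard
      exact ⟨j, Finset.mem_range.1 hj, fun i hi => hj' (Finset.mem_image.2 ⟨i, by simp, hi⟩)⟩
    obtain ⟨D, ⟨hbD, hD⟩, hcD⟩ := hc m e p.stem b p.reservoir p.reservoir_mem j h
    classical
    let P (x : ℕ) : Fin m := if hx : ∃ i, x ∈ A i then hx.choose else i₀
    have hP : ∀ x ∈ X₀, B < x → x ∈ A (P x) := fun x hx hBx => by
      have hx' := hcover x hx hBx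
      simpa only [P, dif_pos hx'] using hx'.choose_spec
    obtain ⟨x, hxD, i, G, hG, hx⟩ := hD P
    -- Raising the bound to the use `u` preserves the acceptance of `x` in every allowed `S`.
    obtain ⟨u, hbu, hu⟩ := hx.exists_use b
    refine ⟨{ p with
      stem := Function.update p.stem i (p.stem i ∪ G), bound := u, stem_subset := ?_ },
      ⟨fun k => ?_, subset_rfl, hpb.trans hbu⟩, i, ?_⟩
    · intro k
      rcases eq_or_ne k i with rfl | hk
      · simp only [Function.update_self, Finset.coe_union, Set.union_subset_iff]
        refine ⟨p.stem_subset k, fun y hy => ?_⟩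
        obtain ⟨hyX, hby, rfl⟩ := hG y hy
        exact hP y (p.reservoir_subset hyX) (hBb.trans_lt hby)
      · simpa [hk] using p.stem_subset k
    · rcases eq_or_ne k i with rfl | hk
      · refine ⟨by simp, fun y hy => ?_⟩
        simp only [Function.update_self, Finset.coe_union, Set.mem_union, Finset.mem_coe] at hy
        exact hy.imp_right fun hy => ⟨(hG y hy).1, hpb.trans_lt (hG y hy).2.1⟩
      · exact ⟨by simp [hk], fun y hy => Or.inl (by simpa [hk] using hy)⟩
    · rintro S ⟨hS, hS'⟩ ⟨-, hhom⟩
      simp only [Function.update_self, Finset.coe_union, Finset.mem_union] at hS hS'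
      have hxS : (e i).Accepts S x := hu S fun y hy => ⟨fun h => hS h, fun h => by
        rcases hS' y h with h | ⟨-, h⟩
        · simpa using h
        · exact absurd h hy.not_gt⟩
      have := hhom x ((hrb i).trans_lt (hbD x hxD)) hxS
      simp only [hcD x hxD, Nat.mod_eq_of_lt hjK] at this
      exact hj i this.symm
  · push Not at h
    obtain ⟨n, hn⟩ := h
    have hblock : ∃ P, ∀ x > max n b, ¬ CanAccept p.reservoir e p.stem b P x := by
      by_contra! h
      obtain ⟨D, hD, hD'⟩ := exists_finset_canAccept h
      obtain ⟨x, hx, hxn⟩ := hn D ⟨fun x hx => (le_max_right _ _).trans_lt (hD x hx), hD'⟩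
      exact absurd ((le_max_left _ _).trans_lt (hD x hx)) (not_lt.2 hxn)
    obtain ⟨P, hP, hPN⟩ := hN m e p.stem b (max n b) p.reservoir p.reservoir_mem hblock
    obtain ⟨i, hi⟩ : ∃ i, (p.reservoir ∩ P ⁻¹' {i}).Infinite := by
      by_contra! h
      refine p.reservoir_infinite ((Set.finite_iUnion h).subset fun x hx => ?_)
      exact Set.mem_iUnion.2 ⟨P x, hx, rfl⟩
    refine ⟨{ p with
      reservoir := p.reservoir ∩ P ⁻¹' {i}
      bound := b
      reservoir_mem := hPN i
      reservoir_infinite := hi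
      reservoir_subset := Set.inter_subset_left.trans p.reservoir_subset },
      ⟨fun k => ⟨subset_rfl, fun y hy => Or.inl hy⟩, Set.inter_subset_left, hpb⟩, i, ?_⟩
    rintro S ⟨hS, hS'⟩ ⟨hinf, -⟩
    obtain ⟨x, hx, hnx⟩ := hinf.exists_gt (max n b)
    obtain ⟨u, -, hu⟩ := OracleCode.Accepts.exists_use hx 0
    classical
    -- The new elements of `S` below the use form a finite extension inside part `i` of `P`, which
    -- the blocking forbids.
    refine hP x hnx ⟨i, {y ∈ Finset.range u | y ∈ S ∧ y ∉ p.stem i}, fun y hy => ?_,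
      hu _ fun y hy => ?_⟩
    · simp only [Finset.mem_filter] at hy
      obtain ⟨⟨h1, h2⟩, h3⟩ := (hS' y hy.2.1).resolve_left hy.2.2
      exact ⟨h1, h3, h2⟩
    · by_cases hyi : y ∈ p.stem i
      · simp [hyi, hS hyi]
      · simp [hyi, hy]

end Condition

/-- Induction on the number of parts. A part almost disjoint from some infinite reservoir in `N` is
dropped, which is why the parts need only cover `X₀` up to a finite set. If there is no such part,
all stems can grow forever, and a sufficiently generic sequence of conditions gives the sets. -/
theorem exists_subset_not_computesHomogeneous {N : Set (Set ℕ)} (hN : ClosedUnderBlocking N)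
    {c : ℕ → ℕ} (hc : GenericOver N c) {K m : ℕ} (hK : m < K) (A : Fin m → Set ℕ) {X₀ : Set ℕ}
    (hX₀ : X₀ ∈ N) (hinf : X₀.Infinite) (hA : (X₀ \ ⋃ i, A i).Finite) :
    ∃ i, ∃ S ⊆ A i, S.Infinite ∧ ∀ r, ¬ ComputesHomogeneous (fun x => c x % K) S r := by
  induction m generalizing X₀ with
  | zero => simp [hinf.not_finite] at hA
  | succ m ih =>
    by_cases hsmall : ∃ X ∈ N, X ⊆ X₀ ∧ X.Infinite ∧ ∃ i, (X ∩ A i).Finite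
    · obtain ⟨X, hX, hXX₀, hXinf, i, hi⟩ := hsmall
      obtain ⟨k, hk⟩ := ih (by omega) (fun k => A (i.succAbove k)) hX hXinf (by
        refine (hA.union hi).subset fun x hx => ?_
        by_cases hxi : x ∈ A i
        · exact Or.inr ⟨hx.1, hxi⟩
        · refine Or.inl ⟨hXX₀ hx.1, fun hx' => hx.2 ?_⟩
          obtain ⟨k, hk⟩ := Set.mem_iUnion.1 hx'
          obtain ⟨k, rfl⟩ := Fin.exists_succAbove_eq (x := k) (y := i) (by rintro rfl; exact hxi hk)
          exact Set.mem_iUnion.2 ⟨k, hk⟩)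
      exact ⟨_, hk⟩
    · push Not at hsmall
      let p₀ : Condition N A X₀ := ⟨fun _ => ∅, X₀, 0, by simp, hX₀, hinf, subset_rfl⟩
      have := Encodable.ofCountable OracleCode
      let cof : (Fin (m + 1) × ℕ) ⊕ (Fin (m + 1) → OracleCode × ℕ × ℕ) →
          Order.Cofinal (Condition N A X₀) := Sum.elim
        (fun t => ⟨{q | ∃ x ∈ q.stem t.1, t.2 < x}, fun p => by
          obtain ⟨q, hpq, hq⟩ := p.exists_le_stem hsmall t.1 t.2
          exact ⟨q, hq, hpq⟩⟩)
        (fun r => ⟨{q | ∃ i, ∀ S, q.Allows i S →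
            ¬ ComputesHomogeneous (fun x => c x % K) S (r i)}, fun p => by
          obtain ⟨q, hpq, hq⟩ := p.exists_le_not_computesHomogeneous hN hc hK hA r
          exact ⟨q, hq, hpq⟩⟩)
      let s := Order.sequenceOfCofinals p₀ cof
      have hs : Monotone s := Order.sequenceOfCofinals.monotone p₀ cof
      let S (i : Fin (m + 1)) : Set ℕ := ⋃ n, ↑((s n).stem i)
      have hallows (n : ℕ) (i : Fin (m + 1)) : (s n).Allows i (S i) := by
        refine ⟨Set.subset_iUnion (fun n => ((s n).stem i : Set ℕ)) n, fun x hx => ?_⟩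
        obtain ⟨k, hk⟩ := Set.mem_iUnion.1 hx
        rcases le_total k n with hkn | hnk
        · exact Or.inl (((Condition.le_def.1 (hs hkn)).1 i).1 hk)
        · exact ((Condition.le_def.1 (hs hnk)).1 i).2 x hk
      have hSA (i : Fin (m + 1)) : S i ⊆ A i := Set.iUnion_subset fun n => (s n).stem_subset i
      have hSinf (i : Fin (m + 1)) : (S i).Infinite := Set.infinite_of_forall_exists_gt fun n => by
        obtain ⟨x, hx, hnx⟩ := Order.sequenceOfCofinals.encode_mem p₀ cof (Sum.inl (i, n))
        exact ⟨x, Set.mem_iUnion.2 ⟨_, hx⟩, hnx⟩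
      by_contra! h
      -- If every `S i` failed, the failures would form a single tuple `r`, which the sequence has
      -- already handled.
      choose r hr using fun i => h i (S i) (hSA i) (hSinf i)
      obtain ⟨i, hi⟩ := Order.sequenceOfCofinals.encode_mem p₀ cof (Sum.inr r)
      exact hi (S i) (hallows _ i) (hr i)

/-! ### From cohesive sets to almost homogeneous sets. -/

/-- An infinite set that is cohesive for the colour classes of all colourings `c mod (k + 1)` is
almost homogeneous for each of them. -/
theorem IsCohesive.exists_almost_homogeneous {c : ℕ → ℕ} {C : Set ℕ}
    (hC : IsCohesive (fun p => {x | c x % (p.unpair.1 + 1) = p.unpair.2}) C) (k : ℕ) :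
    ∃ g b, ∀ x > b, x ∈ C → c x % (k + 1) = g := by
  obtain ⟨g, hg⟩ : ∃ g, (C ∩ {x | c x % (k + 1) = g}).Infinite := by
    by_contra! h
    refine hC.1 (((Set.finite_Iio (k + 1)).biUnion fun g _ => h g).subset fun x hx => ?_)
    exact Set.mem_iUnion₂.2 ⟨c x % (k + 1), Nat.mod_lt _ k.succ_pos, hx, rfl⟩
  have h := hC.2 (Nat.pair k g)
  simp only [Nat.unpair_pair] at h
  obtain ⟨b, hb⟩ := (h.resolve_left hg).bddAbove
  refine ⟨g, b, fun x hx hxC => ?_⟩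
  by_contra hne
  exact absurd (hb ⟨hxC, hne⟩) (not_le.2 hx)

end CohesiveAvoidance

theorem theorem1p5 :
    ∃ R : ℕ → Set ℕ, ∀ (m : ℕ) (A : Fin m → Set ℕ),
      CohesiveAvoidance.IsPartition A →
      (∀ j, CohesiveAvoidance.ArithmeticalIn (CohesiveAvoidance.join R) (A j)) →
      ∃ j, ∃ S : Set ℕ, S ⊆ A j ∧ S.Infinite ∧
        ∀ C : Set ℕ, CohesiveAvoidance.Computes S C → ¬ CohesiveAvoidance.IsCohesive R C := by
  open CohesiveAvoidance in
  obtain ⟨N, hN, huniv, hblock⟩ := exists_closedUnderBlocking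
  obtain ⟨c, hc⟩ := exists_genericOver hN
  -- All moduli occur, so one sequence serves every `m`; modulus `m + 1` gives one colour more than
  -- there are parts.
  refine ⟨fun p => {x | c x % (p.unpair.1 + 1) = p.unpair.2}, fun m A hA _ => ?_⟩
  obtain ⟨j, S, hSA, hS, hr⟩ := exists_subset_not_computesHomogeneous hblock hc (Nat.lt_succ_self m)
    A huniv Set.infinite_univ (by simp [hA.2])
  refine ⟨j, S, hSA, hS, fun C hSC hC => ?_⟩
  obtain ⟨e, rfl⟩ := hSC.exists_accepts
  obtain ⟨g, b, hgb⟩ := hC.exists_almost_homogeneous m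
  exact hr (e, g, b) ⟨hC.1, hgb⟩
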